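/- Let $n\in\mathbb N$, $1\le i\le n$, and let $e_i$ be the $i$-th unit vector of $\mathbb{R}^n$. For an open set $\Omega\subseteq\mathbb{R}^n$, let $W^{1,2}(\Omega)$ be the space of real-valued $u\in L^2(\Omega)$ all of whose first-order weak partial derivatives exist and belong to $L^2(\Omega)$; write $u_{x_i}=\partial u/\partial x_i$ for the weak partial derivative. For $h\in\mathbb{R}\setminus\{0\}$ let $$D^h_{x_i}u(x)=\frac{u(x+he_i)-u(x)}{h}$$ be the difference quotient. (1) If $u\in W^{1,2}(\mathbb{R}^n)$, then $\|D^h_{x_i}u\|_{L^2(\mathbb{R}^n)}\le\|u_{x_i}\|_{L^2(\mathbb{R}^n)}$ for every $h\neq0$, and $D^h_{x_i}u\to u_{x_i}$ in $L^2(\mathbb{R}^n)$ as $h\to0$. (2) Let $\Omega\subseteq\mathbb{R}^n$ be open and $u\in W^{1,2}(\Omega)$. For every $h\ne0$ let $\Omega_h$ be the set of all $x$ for which the segment $[x,x+he_i]$ lies in $\Omega$ (it contains every point of $\Omega$ at distance greater than $|h|$ from the complement of $\Omega$, hence every compact $K\subset\Omega$ whose distance from the complement of $\Omega$ is greater than $|h|$).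 Then $\|D^h_{x_i}u\|_{L^2(\Omega_h)}\le\|u_{x_i}\|_{L^2(\Omega)}$ for every $h\neq0$, and $D^h_{x_i}u\to u_{x_i}$ in $L^2(K)$ as $h\to0$ for every compact $K\subset\Omega$, i.e. in $L^2_{\mathrm{loc}}(\Omega)$. Moreover, for every sequence $h_k\to0$ of nonzero reals, $D^{h_k}_{x_i}u(x)\to u_{x_i}(x)$ for almost every $x\in\Omega$. -/

import Mathlib

open MeasureTheory Filter Topology TopologicalSpace
open scoped ENNReal

noncomputable section

/-- The unit vector `e_i` of `ℝⁿ`. -/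
def unitVec {n : ℕ} (i : Fin n) : EuclideanSpace ℝ (Fin n) :=
  EuclideanSpace.single i (1 : ℝ)

/-- The forward difference quotient `(u (x + h e_i) - u x) / h` (meaningful for `h ≠ 0`). -/
def diffQuot {n : ℕ} (i : Fin n) (h : ℝ) (u : EuclideanSpace ℝ (Fin n) → ℝ)
    (x : EuclideanSpace ℝ (Fin n)) : ℝ :=
  (u (x + h • unitVec i) - u x) / h

/-- `v` is a weak partial derivative `∂u/∂x_i` of `u` on the open set `Ω`: both functions are
locally integrable on `Ω`, and `∫_Ω u ∂_i φ = - ∫_Ω v φ` for all `φ ∈ C_c^∞(Ω)`. Values of `u`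
and `v` outside `Ω` are irrelevant. -/
structure IsWeakPartial {n : ℕ} (Ω : Opens (EuclideanSpace ℝ (Fin n))) (i : Fin n)
    (u v : EuclideanSpace ℝ (Fin n) → ℝ) : Prop where
  locInt_fun : LocallyIntegrableOn u (Ω : Set (EuclideanSpace ℝ (Fin n))) volume
  locInt_deriv : LocallyIntegrableOn v (Ω : Set (EuclideanSpace ℝ (Fin n))) volume
  integral_eq : ∀ φ : TestFunction Ω ℝ (⊤ : ℕ∞),
    ∫ x in (Ω : Set (EuclideanSpace ℝ (Fin n))), u x * fderiv ℝ φ x (unitVec i) =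
      - ∫ x in (Ω : Set (EuclideanSpace ℝ (Fin n))), v x * φ x

/-- `u ∈ W^{1,2}(Ω)`: `u ∈ L²(Ω)` has all first-order weak partial derivatives in `L²(Ω)`. -/
structure MemW12 {n : ℕ} (Ω : Opens (EuclideanSpace ℝ (Fin n)))
    (u : EuclideanSpace ℝ (Fin n) → ℝ) : Prop where
  memLp : MemLp u 2 (volume.restrict (Ω : Set (EuclideanSpace ℝ (Fin n))))
  exists_weakPartial : ∀ i : Fin n, ∃ v : EuclideanSpace ℝ (Fin n) → ℝ,
    IsWeakPartial Ω i u v ∧ MemLp v 2 (volume.restrict (Ω : Set (EuclideanSpace ℝ (Fin n))))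

/-- The set of the points `x` for which the whole segment `[x, x + h e_i]` lies in `Ω`. It contains
every point of `Ω` whose distance to the complement of `Ω` is larger than `|h|`. -/
def shiftDomain {n : ℕ} (Ω : Opens (EuclideanSpace ℝ (Fin n))) (i : Fin n) (h : ℝ) :
    Set (EuclideanSpace ℝ (Fin n)) :=
  {x | segment ℝ x (x + h • unitVec i) ⊆ (Ω : Set (EuclideanSpace ℝ (Fin n)))}

end

/-! The difference quotient is a mean value of the weak derivative: if `w` is `v` extended by zero
outside `Ω`, then for almost every `x` whose segment `[x, x + h e_i]` lies in `Ω`, `D^h u(x) = ∫₀¹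
w(x + s h e_i) ds` (`ae_sub_eq_segmentAverage`, `IsWeakPartial.ae_diffQuot_eq_segmentAverage`). No
smooth approximation is needed: the identity is tested against smooth functions, and the fundamental
theorem of calculus is applied to the test function.

All claims then become statements about `segmentAverage` of an `L²` function on the whole space.
Jensen and translation invariance give the norm bound, continuity of translations in `L²` gives norm
convergence, and Lebesgue differentiation on almost every line parallel to `e_i` gives pointwise
convergence. -/

theorem isOpen_setOf_segment_subset {E : Type*} [NormedAddCommGroup E] [NormedSpace ℝ E]
    {Ω : Set E} (hΩ : IsOpen Ω) (e : E) :
    IsOpen {x | segment ℝ x (x + e) ⊆ Ω} := by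
  rw [Metric.isOpen_iff]
  intro x hx
  have hc : IsCompact (segment ℝ x (x + e)) := by
    rw [segment_eq_image']
    exact isCompact_Icc.image (by fun_prop)
  obtain ⟨δ, hδ, hsub⟩ := hc.exists_thickening_subset_open hΩ hx
  refine ⟨δ, hδ, fun y hy => ?_⟩
  refine subset_trans ?_ hsub
  rw [segment_eq_image']
  rintro _ ⟨θ, hθ, rfl⟩
  refine Metric.mem_thickening_iff.2 ⟨x + θ • e, ?_, ?_⟩
  · rw [segment_eq_image']
    exact ⟨θ, hθ, by simp⟩
  · simpa using hy

/-! ### Increments as segment averages of the weak derivative -/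

section SegmentAverage

variable {E : Type*} [NormedAddCommGroup E] [NormedSpace ℝ E] [FiniteDimensional ℝ E]
  [MeasurableSpace E] [BorelSpace E] {μ : Measure E} [μ.IsAddHaarMeasure]

/-- The mean value of `W` over the segment `[x, x + e]`. -/
noncomputable def segmentAverage (W : E → ℝ) (e x : E) : ℝ :=
  ∫ s in Set.Icc (0 : ℝ) 1, W (x + s • e)

theorem measurePreserving_shear (ν : Measure ℝ) [SFinite ν] (e : E) :
    MeasurePreserving (fun p : ℝ × E => (p.1, p.2 + p.1 • e)) (ν.prod μ) (ν.prod μ) := by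
  refine (MeasurePreserving.id ν).skew_product (g := fun (s : ℝ) (x : E) => x + s • e) ?_ ?_
  · exact Continuous.measurable (by fun_prop)
  · exact ae_of_all _ fun s => (measurePreserving_add_right μ (s • e)).map_eq

theorem integrable_shear {W : E → ℝ} (hW : LocallyIntegrable W μ) (e : E) {I : Set ℝ}
    (hI : IsCompact I) {K : Set E} (hK : IsCompact K) :
    Integrable (fun p : ℝ × E => W (p.2 + p.1 • e))
      ((volume.restrict I).prod (μ.restrict K)) := by
  set C : Set E := (fun p : ℝ × E => p.2 + p.1 • e) '' (I ×ˢ K)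
  have hC : IsCompact C := (hI.prod hK).image (by fun_prop)
  have : IsFiniteMeasure (volume.restrict I) := ⟨by simpa using hI.measure_lt_top⟩
  have h1 : Integrable (C.indicator W) μ :=
    (hW.integrableOn_isCompact hC).integrable_indicator hC.measurableSet
  have h2 : Integrable (fun p : ℝ × E => C.indicator W (p.2 + p.1 • e))
      ((volume.restrict I).prod μ) :=
    ((measurePreserving_shear (μ := μ) (volume.restrict I) e).integrable_comp_of_integrable
      (h1.comp_snd (volume.restrict I)))
  have h3 : (volume.restrict I).prod (μ.restrict K) = (volume.prod μ).restrict (I ×ˢ K) :=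
    Measure.prod_restrict I K
  have h4 : Integrable (fun p : ℝ × E => C.indicator W (p.2 + p.1 • e))
      ((volume.restrict I).prod (μ.restrict K)) := by
    refine h2.mono_measure ?_
    exact Measure.prod_mono le_rfl Measure.restrict_le_self
  refine h4.congr ?_
  rw [h3]
  filter_upwards [ae_restrict_mem (hI.measurableSet.prod hK.measurableSet)] with p hp
  exact Set.indicator_of_mem (Set.mem_image_of_mem _ hp) _

theorem integrable_mul_shear {W k : E → ℝ} (hW : LocallyIntegrable W μ) (hk : Continuous k)
    (hkc : HasCompactSupport k) (e : E) {I : Set ℝ} (hI : IsCompact I) :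
    Integrable (fun p : ℝ × E => k p.2 * W (p.2 + p.1 • e)) ((volume.restrict I).prod μ) := by
  obtain ⟨C, hC⟩ := hk.bounded_above_of_compact_support hkc
  have h1 := (integrable_shear hW e hI hkc.isCompact).bdd_mul (c := C) (f := fun p => k p.2)
    (hk.comp continuous_snd).aestronglyMeasurable (ae_of_all _ fun p => hC p.2)
  have h3 : (volume.restrict I).prod (μ.restrict (tsupport k)) =
      ((volume.restrict I).prod μ).restrict (Set.univ ×ˢ tsupport k) := by
    rw [← Measure.prod_restrict, Measure.restrict_univ]
  rw [h3] at h1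
  refine (integrableOn_iff_integrable_of_support_subset ?_).1 h1
  intro p hp
  refine ⟨trivial, subset_tsupport _ ?_⟩
  exact left_ne_zero_of_mul hp

theorem locallyIntegrable_segmentAverage {W : E → ℝ} (hW : LocallyIntegrable W μ) (e : E) :
    LocallyIntegrable (segmentAverage W e) μ := by
  rw [locallyIntegrable_iff]
  intro K hK
  exact (integrable_shear hW e isCompact_Icc hK).integral_prod_right

theorem locallyIntegrable_comp_add_right {U : E → ℝ} (hU : LocallyIntegrable U μ) (a : E) :
    LocallyIntegrable (fun x => U (x + a)) μ := by
  rw [locallyIntegrable_iff]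
  intro K hK
  have h := (measurePreserving_add_right μ a).integrableOn_image (s := K) (f := U)
    (Homeomorph.addRight a).measurableEmbedding
  exact h.1 (hU.integrableOn_isCompact (hK.image (continuous_add_const a)))

/-- A translation moves the increment from `U` to `g`; `g (y - e) - g y` is minus the integral over
`s` of the derivative of `g` at `y - s • e` along `e`. Fubini, `hUW` for each fixed `s`, and the
reverse translation finish. -/
theorem integral_mul_sub_eq_integral_mul_segmentAverage {U W g : E → ℝ} {e : E}
    (hU : LocallyIntegrable U μ) (hW : LocallyIntegrable W μ)
    (hg : ContDiff ℝ 1 g) (hgc : HasCompactSupport g)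
    (hUW : ∀ s ∈ Set.Icc (0 : ℝ) 1, ∫ y, U y * fderiv ℝ g (y - s • e) e ∂μ =
      - ∫ y, W y * g (y - s • e) ∂μ) :
    ∫ x, g x * (U (x + e) - U x) ∂μ = ∫ x, g x * segmentAverage W e x ∂μ := by
  set I := Set.Icc (0 : ℝ) 1
  have hI : IsCompact I := isCompact_Icc
  have hdg : Continuous fun x => fderiv ℝ g x e :=
    (hg.continuous_fderiv one_ne_zero).clm_apply continuous_const
  have hdgc : HasCompactSupport fun x => fderiv ℝ g x e := hgc.fderiv_apply ℝ e
  have hint1 := integrable_mul_shear (μ := μ) hW hg.continuous hgc e hI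
  have hint2 : Integrable (fun p : ℝ × E => fderiv ℝ g (p.2 - p.1 • e) e * U p.2)
      ((volume.restrict I).prod μ) := by
    -- The shear along `-e` undoes the one in `integrable_mul_shear`, moving the shift from `U` to
    -- the derivative of `g`.
    have := (measurePreserving_shear (μ := μ) (volume.restrict I) (-e)).integrable_comp_of_integrable
      (integrable_mul_shear (μ := μ) hU hdg hdgc e hI)
    refine this.congr (ae_of_all _ fun p => ?_)
    simp [sub_eq_add_neg]
  have hftc (y : E) : g (y - e) - g y = - ∫ s in I, fderiv ℝ g (y - s • e) e := by
    have h1 : ∀ s ∈ Set.uIcc (0 : ℝ) 1,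
        HasDerivAt (fun s : ℝ => g (y - s • e)) (-(fderiv ℝ g (y - s • e) e)) s := by
      intro s _
      have h2 : HasDerivAt (fun s : ℝ => y - s • e) (-e) s := by
        simpa using ((hasDerivAt_id s).smul_const e).const_sub y
      have h3 := ((hg.differentiable one_ne_zero (y - s • e)).hasFDerivAt).comp_hasDerivAt s h2
      exact h3.congr_deriv (by simp)
    have h4 := intervalIntegral.integral_eq_sub_of_hasDerivAt h1
      (Continuous.intervalIntegrable (hdg.comp (by fun_prop)).neg 0 1)
    simp only [one_smul, zero_smul, sub_zero] at h4
    rw [← h4, intervalIntegral.integral_of_le zero_le_one, ← integral_Icc_eq_integral_Ioc,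
      integral_neg]
  have hgU (a : E) : Integrable (fun x => g x * U (x + a)) μ := by
    have hL : LocallyIntegrable (fun x => U (x + a)) μ := locallyIntegrable_comp_add_right hU a
    simpa using hL.integrable_smul_left_of_hasCompactSupport hg.continuous hgc
  have hgU' : Integrable (fun y => g (y - e) * U y) μ := by
    have := (measurePreserving_sub_right μ e).integrable_comp_of_integrable (hgU e)
    simpa [Function.comp_def] using this
  calc ∫ x, g x * (U (x + e) - U x) ∂μ
      = (∫ x, g x * U (x + e) ∂μ) - ∫ x, g x * U x ∂μ := by
        rw [← integral_sub (hgU e) (by simpa using hgU 0)]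
        simp only [mul_sub]
    _ = (∫ y, g (y - e) * U y ∂μ) - ∫ x, g x * U x ∂μ := by
        rw [← integral_sub_right_eq_self (fun x => g x * U (x + e)) e]
        simp
    _ = ∫ y, (g (y - e) - g y) * U y ∂μ := by
        rw [← integral_sub hgU' (by simpa using hgU 0)]
        simp only [sub_mul]
    _ = - ∫ y, (∫ s in I, fderiv ℝ g (y - s • e) e * U y) ∂μ := by
        rw [← integral_neg]
        congr 1 with y
        rw [hftc, integral_mul_const, neg_mul]
    _ = - ∫ s in I, ∫ y, fderiv ℝ g (y - s • e) e * U y ∂μ := by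
        rw [integral_integral_swap (f := fun y s => fderiv ℝ g (y - s • e) e * U y) hint2.swap]
    _ = ∫ s in I, ∫ x, g x * W (x + s • e) ∂μ := by
        rw [← integral_neg]
        refine setIntegral_congr_fun measurableSet_Icc fun s hs => ?_
        have := hUW s hs
        simp only [mul_comm (fderiv ℝ g _ e)]
        rw [this, neg_neg, ← integral_sub_right_eq_self (fun x => g x * W (x + s • e)) (s • e)]
        simp [mul_comm]
    _ = ∫ x, (∫ s in I, g x * W (x + s • e)) ∂μ := integral_integral_swap hint1
    _ = ∫ x, g x * segmentAverage W e x ∂μ := by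
        simp only [integral_const_mul]; rfl

/-- If `g` is supported where `[x, x + e]` stays in `Ω`, all its translates by `s • e`, `0 ≤ s ≤ 1`,
are supported in `Ω`. Thus only test functions in `Ω` occur, and zero extensions are admissible
although they need not be weakly differentiable across the boundary. -/
theorem ae_sub_eq_segmentAverage {Ω : Set E} (hΩ : IsOpen Ω) {U W : E → ℝ} {e : E}
    (hU : LocallyIntegrable U μ) (hW : LocallyIntegrable W μ)
    (hUW : ∀ φ : E → ℝ, ContDiff ℝ (⊤ : ℕ∞) φ → HasCompactSupport φ → tsupport φ ⊆ Ω →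
      ∫ y, U y * fderiv ℝ φ y e ∂μ = - ∫ y, W y * φ y ∂μ) :
    ∀ᵐ x ∂μ, segment ℝ x (x + e) ⊆ Ω → U (x + e) - U x = segmentAverage W e x := by
  have hL : LocallyIntegrable (fun x => U (x + e)) μ := locallyIntegrable_comp_add_right hU e
  have hA := locallyIntegrable_segmentAverage hW e
  have h := (isOpen_setOf_segment_subset hΩ e).ae_eq_zero_of_integral_contDiff_smul_eq_zero
    (μ := μ) (f := fun x => U (x + e) - U x - segmentAverage W e x)
    (((hL.sub hU).sub hA).locallyIntegrableOn _) ?_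
  · filter_upwards [h] with x hx hxD
    exact sub_eq_zero.1 (hx hxD)
  intro g hg hgc hgs
  have key := integral_mul_sub_eq_integral_mul_segmentAverage hU hW (hg.of_le (by simp)) hgc
    (e := e) ?_
  · have i1 := (hL.sub hU).integrable_smul_left_of_hasCompactSupport hg.continuous hgc
    have i2 := hA.integrable_smul_left_of_hasCompactSupport hg.continuous hgc
    have : (fun x => g x • (U (x + e) - U x - segmentAverage W e x)) =
        fun x => g x * (U (x + e) - U x) - g x * segmentAverage W e x := by
      ext x; simp [mul_sub]
    rw [this, integral_sub, key, sub_self]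
    · simpa using i1
    · simpa using i2
  intro s hs
  have hts : tsupport (fun y => g (y - s • e)) ⊆ (fun y => y - s • e) ⁻¹' tsupport g :=
    tsupport_comp_subset_preimage g (continuous_sub_right _)
  have := hUW (fun y => g (y - s • e)) (hg.comp (by fun_prop))
    (hgc.comp_homeomorph (Homeomorph.subRight (s • e))) ?_
  · simpa [fderiv_comp_sub] using this
  · intro y hy
    refine hgs (hts hy) ?_
    rw [segment_eq_image']
    exact ⟨s, hs, by simp⟩

end SegmentAverage

/-! ### Bounds and convergence of segment averages -/

theorem eLpNorm_two_sq_eq_lintegral {α : Type*} [MeasurableSpace α] (μ : Measure α) (f : α → ℝ) :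
    eLpNorm f 2 μ ^ 2 = ∫⁻ x, ‖f x‖ₑ ^ 2 ∂μ := by
  have h := eLpNorm_nnreal_pow_eq_lintegral (μ := μ) (f := f) (p := 2) two_ne_zero
  simpa using h

/-- Jensen for the square, in the form `L¹ ≤ L²` on the probability space `ν`, followed by Tonelli.
-/
theorem eLpNorm_two_integral_le {α β : Type*} [MeasurableSpace α] [MeasurableSpace β]
    {ν : Measure α} {μ : Measure β} [IsProbabilityMeasure ν] [SFinite μ] {F : α → β → ℝ}
    (hF : AEStronglyMeasurable (Function.uncurry F) (ν.prod μ)) {C : ℝ≥0∞}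
    (hC : ∀ᵐ s ∂ν, eLpNorm (F s) 2 μ ≤ C) :
    eLpNorm (fun x => ∫ s, F s x ∂ν) 2 μ ≤ C := by
  have hF2 : AEMeasurable (Function.uncurry fun s x => ‖F s x‖ₑ ^ 2) (ν.prod μ) :=
    hF.enorm.pow_const 2
  have hsec : ∀ᵐ x ∂μ, AEStronglyMeasurable (fun s => F s x) ν := hF.prod_swap.prodMk_left
  refine (ENNReal.pow_le_pow_left_iff two_ne_zero).1 ?_
  calc eLpNorm (fun x => ∫ s, F s x ∂ν) 2 μ ^ 2
      = ∫⁻ x, ‖∫ s, F s x ∂ν‖ₑ ^ 2 ∂μ := eLpNorm_two_sq_eq_lintegral _ _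
    _ ≤ ∫⁻ x, ∫⁻ s, ‖F s x‖ₑ ^ 2 ∂ν ∂μ := by
        refine lintegral_mono_ae ?_
        filter_upwards [hsec] with x hx
        rw [← eLpNorm_two_sq_eq_lintegral ν fun s => F s x]
        gcongr
        calc ‖∫ s, F s x ∂ν‖ₑ ≤ ∫⁻ s, ‖F s x‖ₑ ∂ν := enorm_integral_le_lintegral_enorm _
          _ = eLpNorm (fun s => F s x) 1 ν := eLpNorm_one_eq_lintegral_enorm.symm
          _ ≤ _ := eLpNorm_le_eLpNorm_of_exponent_le (by norm_num) hx
    _ = ∫⁻ s, ∫⁻ x, ‖F s x‖ₑ ^ 2 ∂μ ∂ν := (lintegral_lintegral_swap hF2).symm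
    _ ≤ ∫⁻ _, C ^ 2 ∂ν := by
        refine lintegral_mono_ae ?_
        filter_upwards [hC] with s hs
        rw [← eLpNorm_two_sq_eq_lintegral μ (F s)]
        gcongr
    _ = C ^ 2 := by simp

/-- The substitution `t = r + h s` turns the average into a slope of a primitive along the line,
ready for Lebesgue differentiation. -/
theorem segmentAverage_smul_line {E : Type*} [NormedAddCommGroup E] [NormedSpace ℝ E]
    (W : E → ℝ) (e x : E) (r : ℝ) {h : ℝ} (hh : h ≠ 0) :
    segmentAverage W (h • e) (x + r • e) = h⁻¹ * ∫ t in r..r + h, W (x + t • e) := by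
  rw [segmentAverage, integral_Icc_eq_integral_Ioc, ← intervalIntegral.integral_of_le zero_le_one]
  have := intervalIntegral.integral_comp_add_mul (a := 0) (b := 1)
    (fun t : ℝ => W (x + t • e)) hh r
  simp only [mul_zero, add_zero, mul_one, smul_eq_mul] at this
  rw [← this]
  congr 1 with s
  congr 1
  module

theorem measurable_segmentAverage {E : Type*} [NormedAddCommGroup E] [NormedSpace ℝ E]
    [MeasurableSpace E] [BorelSpace E] {W : E → ℝ} (hW : Measurable W) (e : E) :
    Measurable (segmentAverage W e) := by
  have h : StronglyMeasurable (Function.uncurry fun (x : E) (s : ℝ) => W (x + s • e)) :=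
    (hW.comp (Continuous.measurable (by fun_prop))).stronglyMeasurable
  exact (h.integral_prod_right (ν := volume.restrict (Set.Icc 0 1))).measurable

section SegmentAverage

variable {E : Type*} [NormedAddCommGroup E] [NormedSpace ℝ E] [FiniteDimensional ℝ E]
  [MeasurableSpace E] [BorelSpace E] {μ : Measure E} [μ.IsAddHaarMeasure]

instance isProbabilityMeasure_volume_restrict_Icc_zero_one :
    IsProbabilityMeasure ((volume : Measure ℝ).restrict (Set.Icc 0 1)) :=
  ⟨by simp⟩

theorem aestronglyMeasurable_shear {W : E → ℝ} (hW : AEStronglyMeasurable W μ) (e : E)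
    (ν : Measure ℝ) [SFinite ν] (S : Set E) :
    AEStronglyMeasurable (fun p : ℝ × E => W (p.2 + p.1 • e)) (ν.prod (μ.restrict S)) :=
  (hW.comp_snd.comp_measurePreserving (measurePreserving_shear (μ := μ) ν e)).mono_ac
    (Measure.AbsolutelyContinuous.prod .rfl Measure.absolutelyContinuous_restrict)

theorem eLpNorm_segmentAverage_le {W : E → ℝ} (hW : AEStronglyMeasurable W μ) (e : E)
    (S : Set E) : eLpNorm (segmentAverage W e) 2 (μ.restrict S) ≤ eLpNorm W 2 μ := by
  refine eLpNorm_two_integral_le (F := fun s x => W (x + s • e))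
    (aestronglyMeasurable_shear hW e _ S) (ae_of_all _ fun s => ?_)
  calc eLpNorm (fun x => W (x + s • e)) 2 (μ.restrict S)
      ≤ eLpNorm (fun x => W (x + s • e)) 2 μ := eLpNorm_mono_measure _ Measure.restrict_le_self
    _ = eLpNorm W 2 μ :=
        eLpNorm_comp_measurePreserving hW (measurePreserving_add_right μ (s • e))

theorem tendsto_eLpNorm_translate_sub {W : E → ℝ} (hW : MemLp W 2 μ) :
    Tendsto (fun a : E => eLpNorm (fun x => W (x + a) - W x) 2 μ) (𝓝 0) (𝓝 0) := by
  have : Fact ((1 : ℝ≥0∞) ≤ 2) := ⟨by norm_num⟩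
  let τ : E → C(E, E) := fun a => ⟨fun x => x + a, continuous_add_const a⟩
  have hτ : Continuous τ := ContinuousMap.continuous_of_continuous_uncurry _
    (continuous_snd.add continuous_fst)
  have hmp (a : E) : MeasurePreserving (τ a) μ μ := measurePreserving_add_right μ a
  have h := (tendsto_const_nhds (x := hW.toLp W) (f := 𝓝 (0 : E))).compMeasurePreservingLp
    (hτ.tendsto 0) hmp (hmp 0) (by norm_num)
  rw [tendsto_iff_edist_tendsto_0] at h
  refine h.congr fun a => ?_
  rw [Lp.edist_def]
  refine eLpNorm_congr_ae ?_
  have e0 := hW.coeFn_toLp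
  have e1 := Lp.coeFn_compMeasurePreserving (hW.toLp W) (hmp a)
  have e2 := Lp.coeFn_compMeasurePreserving (hW.toLp W) (hmp 0)
  filter_upwards [e0, e1, e2, (hmp a).quasiMeasurePreserving.ae e0] with x h0 h1 h2 h3
  simp only [Pi.sub_apply]
  rw [h1, h2, Function.comp_apply, Function.comp_apply, h3]
  simp [τ, h0]

theorem ae_locallyIntegrable_line {W : E → ℝ} (hW : LocallyIntegrable W μ) (e : E) :
    ∀ᵐ x ∂μ, LocallyIntegrable (fun t : ℝ => W (x + t • e)) := by
  have h (N : ℕ) : ∀ᵐ x ∂μ, x ∈ Metric.closedBall (0 : E) N →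
      IntegrableOn (fun t : ℝ => W (x + t • e)) (Metric.closedBall (0 : ℝ) N) := by
    have := (integrable_shear hW e (isCompact_closedBall (0 : ℝ) N)
      (isCompact_closedBall (0 : E) N)).prod_left_ae
    exact (ae_restrict_iff' measurableSet_closedBall).1 this
  filter_upwards [ae_all_iff.2 h] with x hx
  rw [locallyIntegrable_iff]
  intro k hk
  obtain ⟨R, hR⟩ := hk.isBounded.subset_closedBall 0
  obtain ⟨N, hN⟩ := exists_nat_ge (max R ‖x‖)
  refine (hx N ?_).mono_set (hR.trans ?_)
  · simpa using (le_max_right _ _).trans hN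
  · exact Metric.closedBall_subset_closedBall ((le_max_left _ _).trans hN)

theorem ae_tendsto_segmentAverage {W : E → ℝ} (hWm : Measurable W) (hW : LocallyIntegrable W μ)
    (e : E) {h : ℕ → ℝ} (h0 : ∀ k, h k ≠ 0) (hh : Tendsto h atTop (𝓝 0)) :
    ∀ᵐ x ∂μ, Tendsto (fun k => segmentAverage W (h k • e) x) atTop (𝓝 (W x)) := by
  set q : E → Prop := fun x =>
    Tendsto (fun k => segmentAverage W (h k • e) x) atTop (𝓝 (W x)) with hq
  -- Measurability of the good set is needed to exchange the two almost-everywhere quantifiers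
  -- below; hence the hypothesis `hWm`.
  have hqm : MeasurableSet {x | q x} :=
    measurableSet_tendsto_fun (fun k => measurable_segmentAverage hWm _) hWm
  have hline : ∀ᵐ x ∂μ, ∀ᵐ r : ℝ, q (x + r • e) := by
    filter_upwards [ae_locallyIntegrable_line hW e] with x hx
    filter_upwards [LocallyIntegrable.ae_hasDerivAt_integral hx] with r hr
    have hd := (hasDerivAt_iff_tendsto_slope_zero.1 (hr r)).comp
      (tendsto_nhdsWithin_iff.2 ⟨hh, Eventually.of_forall h0⟩)
    refine hd.congr fun k => ?_
    simp [segmentAverage_smul_line W e x r (h0 k)]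
  have hsw : ∀ᵐ r : ℝ, ∀ᵐ x ∂μ, q (x + r • e) := by
    refine (Measure.ae_ae_comm (μ := μ) (ν := (volume : Measure ℝ))
      (p := fun x r => q (x + r • e)) ?_).1 hline
    exact hqm.preimage (f := fun p : E × ℝ => p.1 + p.2 • e)
      (Continuous.measurable (by fun_prop))
  -- A single good shift `r` suffices, since translating back by `r • e` preserves null sets.
  obtain ⟨r, hr⟩ := hsw.exists
  filter_upwards [(measurePreserving_sub_right μ (r • e)).quasiMeasurePreserving.ae hr] with x hx
  simpa using hx

theorem tendsto_eLpNorm_segmentAverage_sub {W : E → ℝ} (hW : MemLp W 2 μ) (e : E) :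
    Tendsto (fun h : ℝ => eLpNorm (fun x => segmentAverage W (h • e) x - W x) 2 μ)
      (𝓝 0) (𝓝 0) := by
  rw [ENNReal.tendsto_nhds_zero]
  intro ε hε
  have hT : Tendsto (fun r : ℝ => eLpNorm (fun x => W (x + r • e) - W x) 2 μ) (𝓝 0) (𝓝 0) :=
    (tendsto_eLpNorm_translate_sub hW).comp
      (Continuous.tendsto' (by fun_prop) 0 0 (zero_smul ℝ e) : Tendsto (fun r : ℝ => r • e) _ _)
  obtain ⟨δ, hδ, hball⟩ := Metric.eventually_nhds_iff.1 (ENNReal.tendsto_nhds_zero.1 hT ε hε)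
  filter_upwards [Metric.ball_mem_nhds (0 : ℝ) hδ] with h hh
  have hL : LocallyIntegrable W μ := hW.locallyIntegrable (by norm_num)
  have hs : ∀ᵐ x ∂μ, segmentAverage W (h • e) x - W x =
      ∫ s in Set.Icc (0 : ℝ) 1, (W (x + s • h • e) - W x) := by
    filter_upwards [ae_locallyIntegrable_line hL (h • e)] with x hx
    rw [integral_sub (hx.integrableOn_isCompact isCompact_Icc) (integrable_const _)]
    simp [segmentAverage]
  rw [eLpNorm_congr_ae hs]
  refine eLpNorm_two_integral_le (F := fun s x => W (x + s • h • e) - W x) ?_ ?_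
  · have h1 := aestronglyMeasurable_shear hW.1 (h • e)
      ((volume : Measure ℝ).restrict (Set.Icc 0 1)) Set.univ
    rw [Measure.restrict_univ] at h1
    exact h1.sub hW.1.comp_snd
  · filter_upwards [ae_restrict_mem measurableSet_Icc] with s hs
    -- The shifts `s * h` with `0 ≤ s ≤ 1` are no longer than `h`, so one `δ` serves the whole
    -- average.
    have hsh : dist (s * h) 0 < δ := by
      rw [dist_zero_right, norm_mul, Real.norm_of_nonneg hs.1]
      refine (mul_le_of_le_one_left (norm_nonneg _) hs.2).trans_lt (by simpa using hh)
    simpa [mul_smul] using hball hsh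

end SegmentAverage

/-! ### Transfer to weak derivatives and difference quotients -/

section WeakPartial

variable {n : ℕ} {Ω : Opens (EuclideanSpace ℝ (Fin n))} {i : Fin n}
  {u v w : EuclideanSpace ℝ (Fin n) → ℝ}

theorem IsWeakPartial.ae_eq (hv : IsWeakPartial Ω i u v) (hw : IsWeakPartial Ω i u w) :
    v =ᵐ[volume.restrict (Ω : Set (EuclideanSpace ℝ (Fin n)))] w := by
  have h := Ω.isOpen.ae_eq_zero_of_integral_contDiff_smul_eq_zero (μ := volume)
    (f := fun x => v x - w x) (hv.locInt_deriv.sub hw.locInt_deriv) ?_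
  · refine (ae_restrict_iff' Ω.isOpen.measurableSet).2 ?_
    filter_upwards [h] with x hx hxΩ
    exact sub_eq_zero.1 (hx hxΩ)
  intro g hg hgc hgs
  let φ : TestFunction Ω ℝ (⊤ : ℕ∞) := ⟨g, hg, hgc, hgs⟩
  have hint {f : EuclideanSpace ℝ (Fin n) → ℝ}
      (hf : LocallyIntegrableOn f (Ω : Set (EuclideanSpace ℝ (Fin n))) volume) :
      IntegrableOn (fun x => f x * g x) (Ω : Set (EuclideanSpace ℝ (Fin n))) volume := by
    obtain ⟨C, hC⟩ := hg.continuous.bounded_above_of_compact_support hgc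
    have h1 : IntegrableOn (fun x => f x * g x) (tsupport g) volume :=
      (hf.integrableOn_compact_subset hgs hgc.isCompact).mul_bdd (c := C)
        hg.continuous.aestronglyMeasurable (ae_of_all _ hC)
    have h2 : Integrable (fun x => f x * g x) volume :=
      (integrableOn_iff_integrable_of_support_subset
        fun x (hx : f x * g x ≠ 0) => subset_tsupport _ (right_ne_zero_of_mul hx)).1 h1
    exact h2.integrableOn
  have hzero (x) (hx : x ∉ (Ω : Set (EuclideanSpace ℝ (Fin n)))) : g x = 0 :=
    image_eq_zero_of_notMem_tsupport fun h => hx (hgs h)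
  rw [← setIntegral_eq_integral_of_forall_compl_eq_zero
    (s := (Ω : Set (EuclideanSpace ℝ (Fin n)))) fun x hx => by simp [hzero x hx]]
  have h1 := hv.integral_eq φ
  rw [hw.integral_eq φ, neg_inj] at h1
  have h2 : ∀ x, g x • (v x - w x) = v x * g x - w x * g x := fun x => by
    simp only [smul_eq_mul]; ring
  simp only [h2]
  rw [integral_sub (hint hv.locInt_deriv) (hint hw.locInt_deriv), sub_eq_zero]
  exact h1.symm

theorem MemW12.memLp_weakPartial (hu : MemW12 Ω u) (hv : IsWeakPartial Ω i u v) :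
    MemLp v 2 (volume.restrict (Ω : Set (EuclideanSpace ℝ (Fin n)))) := by
  obtain ⟨w, hw, hwL⟩ := hu.exists_weakPartial i
  exact hwL.ae_eq (hw.ae_eq hv)

theorem IsWeakPartial.ae_diffQuot_eq_segmentAverage (hv : IsWeakPartial Ω i u v)
    (hu : MemLp u 2 (volume.restrict (Ω : Set (EuclideanSpace ℝ (Fin n)))))
    (hw : LocallyIntegrable w volume)
    (hwv : w =ᵐ[volume] (Ω : Set (EuclideanSpace ℝ (Fin n))).indicator v)
    {h : ℝ} (hh : h ≠ 0) :
    ∀ᵐ x, x ∈ shiftDomain Ω i h → diffQuot i h u x = segmentAverage w (h • unitVec i) x := by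
  have hΩ := Ω.isOpen.measurableSet
  have hU : LocallyIntegrable ((Ω : Set (EuclideanSpace ℝ (Fin n))).indicator u) volume :=
    ((memLp_indicator_iff_restrict hΩ).2 hu).locallyIntegrable (by norm_num)
  -- The derivative along `h • unitVec i` is `h` times that along `unitVec i`; this factor cancels
  -- the denominator of `diffQuot`.
  have key := ae_sub_eq_segmentAverage (μ := volume) Ω.isOpen (e := h • unitVec i) hU (hw.smul h) ?_
  · filter_upwards [key] with x hx hxD
    have h1 := hx hxD
    have hx0 : x ∈ (Ω : Set (EuclideanSpace ℝ (Fin n))) := hxD (left_mem_segment ℝ _ _)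
    have hx1 : x + h • unitVec i ∈ (Ω : Set (EuclideanSpace ℝ (Fin n))) :=
      hxD (right_mem_segment ℝ _ _)
    rw [Set.indicator_of_mem hx0, Set.indicator_of_mem hx1] at h1
    rw [diffQuot, h1, div_eq_iff hh]
    simp [segmentAverage, integral_const_mul, mul_comm]
  intro φ hφ hφc hφs
  have h1 := hv.integral_eq ⟨φ, hφ, hφc, hφs⟩
  have h1' : ∫ x in (Ω : Set (EuclideanSpace ℝ (Fin n))), u x * fderiv ℝ φ x (unitVec i) =
    - ∫ x in (Ω : Set (EuclideanSpace ℝ (Fin n))), v x * φ x := h1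
  rw [← integral_indicator hΩ, ← integral_indicator hΩ] at h1'
  simp only [Set.indicator_mul_left] at h1'
  have h2 : ∫ y, (h • w) y * φ y =
      h * ∫ y, (Ω : Set (EuclideanSpace ℝ (Fin n))).indicator v y * φ y := by
    rw [← integral_const_mul]
    refine integral_congr_ae ?_
    filter_upwards [hwv] with y hy
    simp [hy, mul_assoc]
  rw [h2, ← mul_neg, ← h1', ← integral_const_mul]
  congr 1 with y
  simp only [map_smul, smul_eq_mul]
  ring

theorem MemW12.exists_extension_weakPartial (hu : MemW12 Ω u) (hv : IsWeakPartial Ω i u v) :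
    ∃ w : EuclideanSpace ℝ (Fin n) → ℝ, Measurable w ∧ MemLp w 2 volume ∧
      w =ᵐ[volume] (Ω : Set (EuclideanSpace ℝ (Fin n))).indicator v := by
  have h : MemLp ((Ω : Set (EuclideanSpace ℝ (Fin n))).indicator v) 2 volume :=
    (memLp_indicator_iff_restrict Ω.isOpen.measurableSet).2 (hu.memLp_weakPartial hv)
  exact ⟨h.1.mk _, h.1.stronglyMeasurable_mk.measurable, h.ae_eq h.1.ae_eq_mk, h.1.ae_eq_mk.symm⟩

theorem measurableSet_shiftDomain (Ω : Opens (EuclideanSpace ℝ (Fin n))) (i : Fin n) (h : ℝ) :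
    MeasurableSet (shiftDomain Ω i h) :=
  (isOpen_setOf_segment_subset Ω.isOpen (h • unitVec i)).measurableSet

theorem MemW12.eLpNorm_diffQuot_le (hu : MemW12 Ω u) (hv : IsWeakPartial Ω i u v) {h : ℝ}
    (hh : h ≠ 0) :
    eLpNorm (diffQuot i h u) 2 (volume.restrict (shiftDomain Ω i h)) ≤
      eLpNorm v 2 (volume.restrict (Ω : Set (EuclideanSpace ℝ (Fin n)))) := by
  obtain ⟨w, -, hwL, hwv⟩ := hu.exists_extension_weakPartial hv
  have hd := hv.ae_diffQuot_eq_segmentAverage hu.memLp (hwL.locallyIntegrable (by norm_num)) hwv hh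
  rw [eLpNorm_congr_ae ((ae_restrict_iff' (measurableSet_shiftDomain Ω i h)).2 hd),
    ← eLpNorm_indicator_eq_eLpNorm_restrict Ω.isOpen.measurableSet, ← eLpNorm_congr_ae hwv]
  exact eLpNorm_segmentAverage_le hwL.1 _ _

/-- The form of `hSh` covers both compact subsets of `Ω` and the whole space. -/
theorem MemW12.tendsto_eLpNorm_diffQuot_sub (hu : MemW12 Ω u) (hv : IsWeakPartial Ω i u v)
    {S : Set (EuclideanSpace ℝ (Fin n))} (hS : MeasurableSet S)
    (hSΩ : S ⊆ (Ω : Set (EuclideanSpace ℝ (Fin n))))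
    (hSh : ∀ᶠ h in 𝓝 (0 : ℝ), S ⊆ shiftDomain Ω i h) :
    Tendsto (fun h : ℝ => eLpNorm (fun x => diffQuot i h u x - v x) 2 (volume.restrict S))
      (𝓝[≠] 0) (𝓝 0) := by
  obtain ⟨w, -, hwL, hwv⟩ := hu.exists_extension_weakPartial hv
  refine tendsto_of_tendsto_of_tendsto_of_le_of_le' tendsto_const_nhds
    ((tendsto_eLpNorm_segmentAverage_sub hwL (unitVec i)).mono_left nhdsWithin_le_nhds)
    (Eventually.of_forall fun _ => zero_le) ?_
  filter_upwards [self_mem_nhdsWithin, nhdsWithin_le_nhds hSh] with h hh hsub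
  have hd := hv.ae_diffQuot_eq_segmentAverage hu.memLp (hwL.locallyIntegrable (by norm_num)) hwv hh
  have hcongr : (fun x => diffQuot i h u x - v x) =ᵐ[volume.restrict S]
      fun x => segmentAverage w (h • unitVec i) x - w x := by
    refine (ae_restrict_iff' hS).2 ?_
    filter_upwards [hd, hwv] with x hx hwx hxS
    rw [hx (hsub hxS), hwx, Set.indicator_of_mem (hSΩ hxS)]
  rw [eLpNorm_congr_ae hcongr]
  exact eLpNorm_mono_measure _ Measure.restrict_le_self

theorem eventually_subset_shiftDomain (Ω : Opens (EuclideanSpace ℝ (Fin n))) (i : Fin n)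
    {K : Set (EuclideanSpace ℝ (Fin n))} (hK : IsCompact K)
    (hKΩ : K ⊆ (Ω : Set (EuclideanSpace ℝ (Fin n)))) :
    ∀ᶠ h in 𝓝 (0 : ℝ), K ⊆ shiftDomain Ω i h := by
  obtain ⟨δ, hδ, hsub⟩ := hK.exists_thickening_subset_open Ω.isOpen hKΩ
  filter_upwards [Metric.ball_mem_nhds (0 : ℝ) hδ] with h hh x hx
  refine Set.Subset.trans ?_ hsub
  rw [segment_eq_image']
  rintro _ ⟨θ, hθ, rfl⟩
  refine Metric.mem_thickening_iff.2 ⟨x, hx, ?_⟩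
  have h1 : ‖(unitVec i : EuclideanSpace ℝ (Fin n))‖ = 1 := by simp [unitVec]
  rw [add_sub_cancel_left, dist_self_add_left, norm_smul, norm_smul, h1, mul_one,
    Real.norm_of_nonneg hθ.1]
  exact (mul_le_of_le_one_left (norm_nonneg _) hθ.2).trans_lt (by simpa using hh)

theorem MemW12.ae_tendsto_diffQuot (hu : MemW12 Ω u) (hv : IsWeakPartial Ω i u v) {h : ℕ → ℝ}
    (h0 : ∀ k, h k ≠ 0) (hh : Tendsto h atTop (𝓝 0)) :
    ∀ᵐ x ∂(volume.restrict (Ω : Set (EuclideanSpace ℝ (Fin n)))),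
      Tendsto (fun k => diffQuot i (h k) u x) atTop (𝓝 (v x)) := by
  obtain ⟨w, hwm, hwL, hwv⟩ := hu.exists_extension_weakPartial hv
  have hwl : LocallyIntegrable w volume := hwL.locallyIntegrable (by norm_num)
  have hd := ae_all_iff.2 fun k => hv.ae_diffQuot_eq_segmentAverage hu.memLp hwl hwv (h0 k)
  refine (ae_restrict_iff' Ω.isOpen.measurableSet).2 ?_
  filter_upwards [hd, hwv, ae_tendsto_segmentAverage hwm hwl (unitVec i) h0 hh]
    with x hx hwx hlim hxΩ
  rw [hwx, Set.indicator_of_mem hxΩ] at hlim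
  refine hlim.congr' ?_
  -- For a fixed `x` in `Ω` the short segments eventually stay in `Ω`, with a threshold depending on
  -- `x`.
  filter_upwards [hh.eventually (eventually_subset_shiftDomain Ω i isCompact_singleton
    (Set.singleton_subset_iff.2 hxΩ))] with k hk
  exact (hx k (hk rfl)).symm

theorem shiftDomain_top (i : Fin n) (h : ℝ) : shiftDomain ⊤ i h = Set.univ := by
  simp [shiftDomain]

end WeakPartial

theorem theorem4 {n : ℕ} (i : Fin n) :
    -- the whole space
    (∀ u v : EuclideanSpace ℝ (Fin n) → ℝ, MemW12 ⊤ u → IsWeakPartial ⊤ i u v →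
      (∀ h : ℝ, h ≠ 0 → eLpNorm (diffQuot i h u) 2 volume ≤ eLpNorm v 2 volume) ∧
      Tendsto (fun h : ℝ => eLpNorm (fun x => diffQuot i h u x - v x) 2 volume)
        (𝓝[≠] 0) (𝓝 0)) ∧
    -- an arbitrary open set
    (∀ (Ω : Opens (EuclideanSpace ℝ (Fin n))) (u v : EuclideanSpace ℝ (Fin n) → ℝ),
      MemW12 Ω u → IsWeakPartial Ω i u v →
      (∀ h : ℝ, h ≠ 0 →
        eLpNorm (diffQuot i h u) 2 (volume.restrict (shiftDomain Ω i h)) ≤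
          eLpNorm v 2 (volume.restrict (Ω : Set (EuclideanSpace ℝ (Fin n))))) ∧
      (∀ K : Set (EuclideanSpace ℝ (Fin n)), IsCompact K →
        K ⊆ (Ω : Set (EuclideanSpace ℝ (Fin n))) →
        Tendsto (fun h : ℝ => eLpNorm (fun x => diffQuot i h u x - v x) 2 (volume.restrict K))
          (𝓝[≠] 0) (𝓝 0)) ∧
      (∀ h : ℕ → ℝ, (∀ k, h k ≠ 0) → Tendsto h atTop (𝓝 0) →
        ∀ᵐ x ∂(volume.restrict (Ω : Set (EuclideanSpace ℝ (Fin n)))),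
          Tendsto (fun k => diffQuot i (h k) u x) atTop (𝓝 (v x)))) := by
  refine ⟨fun u v hu hv => ⟨fun h hh => ?_, ?_⟩, fun Ω u v hu hv => ⟨fun h hh => ?_,
    fun K hK hKΩ => ?_, fun h h0 hh => hu.ae_tendsto_diffQuot hv h0 hh⟩⟩
  · simpa [shiftDomain_top] using hu.eLpNorm_diffQuot_le hv hh
  · simpa using hu.tendsto_eLpNorm_diffQuot_sub hv MeasurableSet.univ (by simp)
      (Eventually.of_forall fun h => (shiftDomain_top i h).ge)
  · exact hu.eLpNorm_diffQuot_le hv hh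
  · exact hu.tendsto_eLpNorm_diffQuot_sub hv hK.measurableSet hKΩ
      (eventually_subset_shiftDomain Ω i hK hKΩ)
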